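/- All graphs are finite, undirected and loopless, and may have parallel edges. For positive integers $\lambda,m,n$, let $\lambda m K_n$ denote the complete graph on $n$ vertices with every edge replaced by $\lambda m$ parallel edges, and let $\lambda K_{n\times m}$ denote the complete $n$-partite graph with $m$ vertices in each part, with every edge replaced by $\lambda$ parallel edges. A cycle has length at least $2$; a cycle of length $2$ consists of two distinct parallel edges. A decomposition of a graph $G$ is a set of subgraphs of $G$ whose edge sets partition $E(G)$. A cycle decomposition $\{C_1,\dots,C_k\}$ of $G$ consists of $k$ cycles $C_1,\dots,C_k$ in $G$ that decompose $G$, or, in case every vertex of $G$ has odd degree, that together with a single $1$-factor (spanning $1$-regular subgraph) of $G$ decompose $G$; the $1$-factor is not listed among the $C_i$. Theorem. Let $\lambda,m,n$ be positive integers, let $V(\lambda mK_n)=\mathbb{Z}_n$ (the integers modulo $n$), and let $V(\lambda K_{n\times m})=\bigcup_{j\in\mathbb{Z}_n}V_j$, where $V_0,V_1,\dots,V_{n-1}$ are the (pairwise disjoint) parts of $\lambda K_{n\times m}$, each of size $m$. Suppose $\{C_1,\dots,C_k\}$ is a cycle decomposition of $\lambda mK_n$. Then there exists a cycle decomposition $\{C_1',\dots,C_k'\}$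 of $\lambda K_{n\times m}$ such that $$V(C_i')=\bigcup_{j\in V(C_i)}V_j\qquad\text{for each } i\in\{1,\dots,k\}.$$ -/

import Mathlib

namespace CycleDecomp

/-- The `l`-fold graph `l G` of a simple graph `G`: every edge of `G` is replaced by
`l` parallel edges, labelled by the elements of `Fin l`. -/
def foldGraph {α : Type*} (l : ℕ) (G : SimpleGraph α) : Graph α (Sym2 α × Fin l) where
  vertexSet := Set.univ
  IsLink e x y := G.Adj x y ∧ e.1 = s(x, y)
  isLink_symm := by
    intro e _
    exact ⟨fun x y h => ⟨h.1.symm, h.2.trans Sym2.eq_swap⟩⟩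
  eq_or_eq_of_isLink_of_isLink := by
    intro e x y v w h h'
    have h2 : s(x, y) = s(v, w) := h.2.symm.trans h'.2
    rcases Sym2.eq_iff.mp h2 with h3 | h3
    · exact Or.inl h3.1
    · exact Or.inr h3.1
  left_mem_of_isLink := fun _ _ _ _ => Set.mem_univ _

/-- The complete `l`-fold graph `l K_n` on the vertex set `ℤ/n`. -/
abbrev completeMultigraph (l n : ℕ) : Graph (ZMod n) (Sym2 (ZMod n) × Fin l) :=
  foldGraph l (⊤ : SimpleGraph (ZMod n))

/-- The complete `l`-fold multipartite graph whose parts are indexed by `ι` and whose vertex set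
is the disjoint union of the sets `V j`. If `ι` has `n` elements and every `V j` has
`m` elements, this is `l K_{n × m}`. -/
abbrev completeMultipartiteMultigraph {ι : Type*} (l : ℕ) (V : ι → Type*) :
    Graph (Σ j, V j) (Sym2 (Σ j, V j) × Fin l) :=
  foldGraph l (SimpleGraph.completeMultipartiteGraph V)

/-- The part with index `j`, as a set of vertices of the complete multipartite graph. -/
def part {ι : Type*} (V : ι → Type*) (j : ι) : Set (Σ j, V j) :=
  Set.range (Sigma.mk j)

/-- The degree of a vertex of a multigraph; a loop counts twice. -/
noncomputable def degree {α β : Type*} (G : Graph α β) (x : α) : ℕ :=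
  (G.incidenceSet x).ncard + (G.loopSet x).ncard

/-- `H` is a cycle of length at least two: its vertices and its edges can be arranged as
`v 0, e 0, v 1, e 1, …, v (c - 1), e (c - 1), v 0` without repetition, where `e i` joins
`v i` and `v (i + 1)`. A cycle of length two consists of two parallel edges. -/
def IsCycle {α β : Type*} (H : Graph α β) : Prop :=
  ∃ c : ℕ, 2 ≤ c ∧ ∃ (v : ZMod c → α) (e : ZMod c → β),
    Function.Injective v ∧ Function.Injective e ∧
    H.vertexSet = Set.range v ∧ H.edgeSet = Set.range e ∧
    ∀ i, H.IsLink (e i) (v i) (v (i + 1))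

/-- `I` is a 1-factor of `G`: a spanning subgraph in which every vertex has degree one. -/
def IsOneFactor {α β : Type*} (I G : Graph α β) : Prop :=
  I.IsSpanningSubgraph G ∧ ∀ x ∈ G.vertexSet, degree I x = 1

/-- The family `H` of subgraphs of `G` is a decomposition of `G`: the edge set of `G` is
partitioned into the edge sets of the subgraphs. -/
def IsDecomposition {α β κ : Type*} (G : Graph α β) (H : κ → Graph α β) : Prop :=
  (∀ i, H i ≤ G) ∧
  Pairwise (fun i j => Disjoint (H i).edgeSet (H j).edgeSet) ∧
  (⋃ i, (H i).edgeSet) = G.edgeSet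

/-- `{C i}` is a cycle decomposition of `G`: the graph `G` decomposes into the cycles `C i`, or,
in case every vertex of `G` has odd degree, into the cycles `C i` and a single 1-factor.
In the second case the 1-factor is the member with index `none`. -/
def IsCycleDecomposition {α β κ : Type*} (G : Graph α β) (C : κ → Graph α β) : Prop :=
  (∀ i, IsCycle (C i)) ∧
  (IsDecomposition G C ∨
    ((∀ x ∈ G.vertexSet, Odd (degree G x)) ∧
      ∃ I : Graph α β, IsOneFactor I G ∧
        IsDecomposition G (fun o : Option κ => o.elim I C)))

end CycleDecomp

/-! The proof is by amalgamation and detachment. Think of each vertex `j` of $\lambda mK_n$ as the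
whole part $V_j$ shrunk to one point of weight $m$. Traversing every cycle $m$ times and taking
every edge of the 1-factor $m$ times gives closed walks that visit a point exactly $m$ times or not
at all, a factor of degree $m$, and $\lambda\cdot m\cdot m$ edges between any two points. This is a
weighted version of the desired decomposition (`IsDetachment`), and it remains to spread the weights
until all equal one.

A single split (`IsDetachment.exists_split`) moves one unit of weight from a vertex $x$ of weight
$p\ge 2$ to a vertex $y$ of weight zero in the same part. A walk through $x$ falls into $p$ segments
between consecutive visits to $x$. Redirecting to $y$ one end of each of two different segments, and
reversing segments where needed, merges these two segments at a visit to $y$ and leaves a single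
closed walk (`exists_redirect`). In each factor one edge at $x$ is redirected.

The choices must be fair: a vertex $u$ joined to $x$ by $p\lambda g(u)$ edges must lose exactly
$\lambda g(u)$ of them to $y$. Such a choice is a transversal of a bipartite multigraph with left
degrees $p$, found by Hall's theorem (`exists_transversal`, `exists_balanced_selection`).

When all weights are one, each walk visits every vertex of its parts once, so it is a cycle, and the
factor is a 1-factor. -/

namespace CycleDecomp

/-! ### Closed walks as cyclic lists, and their rerouting at a vertex -/

section Walks

variable {α : Type*}

/-- The multiset of edges of the walk that starts at `a`, runs through `l` and ends at `b`. -/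
def pathEdges (a : α) (l : List α) (b : α) : Multiset (Sym2 α) :=
  (List.zipWith (fun x y => s(x, y)) (a :: l) (l ++ [b]) : List (Sym2 α))

@[simp] lemma pathEdges_nil (a b : α) : pathEdges a [] b = {s(a, b)} := rfl

@[simp] lemma pathEdges_cons (a c b : α) (l : List α) :
    pathEdges a (c :: l) b = s(a, c) ::ₘ pathEdges c l b := rfl

lemma pathEdges_append (a c b : α) (l₁ l₂ : List α) :
    pathEdges a (l₁ ++ c :: l₂) b = pathEdges a l₁ c + pathEdges c l₂ b := by
  induction l₁ generalizing a with
  | nil => simp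
  | cons d l ih => simp [ih]

lemma pathEdges_reverse (a b : α) (l : List α) :
    pathEdges a l.reverse b = pathEdges b l a := by
  induction l generalizing b with
  | nil => simp [Sym2.eq_swap]
  | cons d l ih =>
    rw [List.reverse_cons, pathEdges_append, ih, pathEdges_nil, pathEdges_cons, Sym2.eq_swap,
      add_comm, Multiset.singleton_add]

/-- The multiset of edges of the closed walk that runs cyclically through `l`. -/
def cycleEdges : List α → Multiset (Sym2 α)
  | [] => 0
  | a :: l => pathEdges a l a

@[simp] lemma cycleEdges_nil : cycleEdges ([] : List α) = 0 := rfl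

@[simp] lemma cycleEdges_cons (a : α) (l : List α) : cycleEdges (a :: l) = pathEdges a l a := rfl

lemma cycleEdges_append_comm (l₁ l₂ : List α) :
    cycleEdges (l₁ ++ l₂) = cycleEdges (l₂ ++ l₁) := by
  cases l₁ with
  | nil => simp
  | cons a l₁ =>
    cases l₂ with
    | nil => simp
    | cons b l₂ =>
      simp only [List.cons_append, cycleEdges_cons, pathEdges_append]
      exact add_comm _ _

lemma cycleEdges_flatten_replicate (m : ℕ) (l : List α) :
    cycleEdges (List.replicate m l).flatten = m • cycleEdges l := by
  cases l with
  | nil => simp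
  | cons a l =>
    induction m with
    | zero => simp
    | succ m ih =>
      cases m with
      | zero => simp
      | succ m =>
        rw [succ_nsmul', ← ih]
        simp [List.replicate_succ, pathEdges_append]

lemma cycleEdges_eq_zipWith (l : List α) :
    cycleEdges l = (List.zipWith (fun x y => s(x, y)) l (l.rotate 1) : List (Sym2 α)) := by
  cases l with
  | nil => rfl
  | cons a l => simp [pathEdges]

lemma cycleEdges_ofFn {n : ℕ} (v : Fin (n + 1) → α) :
    cycleEdges (List.ofFn v) = Finset.univ.val.map (fun t => s(v t, v (t + 1))) := by
  have h : List.zipWith (fun x y => s(x, y)) (List.ofFn v) ((List.ofFn v).rotate 1)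
      = List.ofFn (fun t => s(v t, v (t + 1))) := by
    apply List.ext_getElem
    · simp
    · intro i h₁ h₂
      simp only [List.getElem_zipWith, List.getElem_ofFn, List.getElem_rotate, List.length_ofFn]
      have : (⟨(i + 1) % (n + 1), Nat.mod_lt _ (Nat.succ_pos n)⟩ : Fin (n + 1))
          = ⟨i, by simpa using h₂⟩ + 1 := Fin.ext (by simp [Fin.val_add])
      rw [this]
  rw [cycleEdges_eq_zipWith, h, Fin.univ_val_map]

/-- The closed walk that runs through `x` and each of the segments in turn. -/
def joinAt (x : α) (ss : List (List α)) : List α := (ss.map (x :: ·)).flatten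

@[simp] lemma joinAt_nil (x : α) : joinAt x [] = [] := rfl

@[simp] lemma joinAt_cons (x : α) (s : List α) (ss : List (List α)) :
    joinAt x (s :: ss) = x :: (s ++ joinAt x ss) := by simp [joinAt]

lemma joinAt_perm {x : α} {ss ss' : List (List α)} (h : ss.Perm ss') :
    (joinAt x ss).Perm (joinAt x ss') := (h.map _).flatten

lemma pathEdges_append_joinAt (a x : α) (s : List α) (ss : List (List α)) :
    pathEdges a (s ++ joinAt x ss) x
      = pathEdges a s x + (ss.map (fun s => pathEdges x s x)).sum := by
  induction ss generalizing a s with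
  | nil => simp
  | cons t ss ih => simp [pathEdges_append, ih]

lemma cycleEdges_joinAt (x : α) (ss : List (List α)) :
    cycleEdges (joinAt x ss) = (ss.map (fun s => pathEdges x s x)).sum := by
  cases ss with
  | nil => simp
  | cons s ss => simp [pathEdges_append_joinAt]

lemma exists_eq_append_joinAt (x : α) (l : List α) :
    ∃ s ss, l = s ++ joinAt x ss ∧ x ∉ s ∧ ∀ t ∈ ss, x ∉ t := by
  classical
  induction l with
  | nil => exact ⟨[], [], by simp⟩
  | cons a l ih =>
    obtain ⟨s, ss, rfl, hs, hss⟩ := ih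
    by_cases h : x = a
    · exact ⟨[], s :: ss, by simp [h], by simp, by simpa [hs] using hss⟩
    · exact ⟨a :: s, ss, by simp, by simp [h, hs], hss⟩

/-- Rotating the closed walk to start at a visit to `x` keeps its edges; cutting it at every visit
to `x` then yields the segments. -/
lemma exists_joinAt {x : α} {l : List α} (hx : x ∈ l) :
    ∃ ss, l.Perm (joinAt x ss) ∧ cycleEdges l = cycleEdges (joinAt x ss) ∧ ∀ t ∈ ss, x ∉ t := by
  obtain ⟨l₁, l₂, rfl⟩ := List.append_of_mem hx
  obtain ⟨s, ss, h, hs, hss⟩ := exists_eq_append_joinAt x (l₂ ++ l₁)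
  have h' : joinAt x (s :: ss) = (x :: l₂) ++ l₁ := by simp [← h]
  refine ⟨s :: ss, ?_, ?_, by simpa [hs] using hss⟩
  · rw [h']; exact List.perm_append_comm
  · rw [h', cycleEdges_append_comm]

lemma count_joinAt [DecidableEq α] {x : α} {ss : List (List α)} (h : ∀ t ∈ ss, x ∉ t) :
    (joinAt x ss).count x = ss.length := by
  induction ss with
  | nil => simp
  | cons s ss ih =>
    simp only [List.mem_cons, forall_eq_or_imp] at h
    simp [ih h.2, List.count_eq_zero_of_not_mem h.1]

lemma perm_getElem_getElem_cons {ss : List α} {a b : Fin ss.length} (h : a ≠ b) :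
    ∃ rest, ss.Perm (ss[a] :: ss[b] :: rest) := by
  classical
  have h₁ := List.getElem_cons_eraseIdx_perm (l := ss) a.2
  have h₂ : ss[b] ∈ ss.eraseIdx a := by
    rw [List.mem_eraseIdx_iff_getElem]
    exact ⟨b, b.2, fun h' => h (Fin.ext h'.symm), rfl⟩
  exact ⟨_, h₁.symm.trans ((List.perm_cons_erase h₂).cons _)⟩

/-- Since `x` is met only at the end of the walk, the last edge is the only one incident with `x`.
-/
lemma count_pathEdges_of_notMem [DecidableEq α] {x : α} (u a : α) {l : List α}
    (h : x ∉ a :: l) :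
    (pathEdges a l x).count s(x, u) = if (a :: l).getLast (by simp) = u then 1 else 0 := by
  induction l generalizing a with
  | nil =>
    have : x ≠ a := by simpa using h
    simp only [pathEdges_nil, Multiset.count_singleton, List.getLast_singleton, Sym2.eq_iff]
    grind
  | cons b l ih =>
    have h₁ : x ∉ b :: l := fun h' => h (List.mem_cons_of_mem _ h')
    have h₂ : s(x, u) ≠ s(a, b) := by
      simp only [ne_eq, Sym2.eq_iff]
      grind
    rw [pathEdges_cons, Multiset.count_cons_of_ne h₂, ih b h₁]
    simp

/-- The two ends of a segment of a closed walk between consecutive visits to `x`, and the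
effect of redirecting one of them to another vertex `y`. -/
lemma exists_segment_ends [DecidableEq α] {x : α} {s : List α} (hs : s ≠ []) (hx : x ∉ s) :
    ∃ e : Bool → α,
      (∀ u, (pathEdges x s x).count s(x, u) = (Finset.univ.filter (fun z => e z = u)).card) ∧
      ∀ z, ∃ s', s'.Perm s ∧
        ∀ y, pathEdges x s' y + {s(x, e z)} = pathEdges x s x + {s(y, e z)} := by
  have key : ∀ (s : List α) (hs : s ≠ []) (y : α), pathEdges x s y + {s(x, s.getLast hs)}
      = pathEdges x s x + {s(y, s.getLast hs)} := by
    intro s hs y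
    obtain ⟨t, u, rfl⟩ : ∃ t u, s = t ++ [u] := ⟨_, _, (List.dropLast_append_getLast hs).symm⟩
    simp only [pathEdges_append, pathEdges_nil, List.getLast_append_singleton]
    rw [Sym2.eq_swap (a := u), Sym2.eq_swap (a := u), add_assoc, add_assoc,
      add_comm ({s(y, u)} : Multiset (Sym2 α))]
  -- A one-vertex segment still has two ends, one for each of its two edges to `x`. The redirected
  -- end has to come last, so redirecting the first end means reversing the segment.
  refine ⟨fun z => if z then s.head hs else s.getLast hs, fun u => ?_, fun z => ?_⟩
  · cases s with
    | nil => exact absurd rfl hs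
    | cons a t =>
      have hxa : x ≠ a := by grind
      rw [pathEdges_cons, Multiset.count_cons, count_pathEdges_of_notMem u a hx]
      have : (s(x, u) = s(x, a)) ↔ a = u := by
        simp only [Sym2.eq_iff]; grind
      simp only [this, Finset.card_filter, Fintype.sum_bool]
      simp [add_comm]
  · cases z with
    | false => exact ⟨s, List.Perm.refl _, fun y => by simpa using key s hs y⟩
    | true =>
      refine ⟨s.reverse, List.reverse_perm s, fun y => ?_⟩
      have h := key s.reverse (by simpa using hs) y
      rw [List.getLast_reverse] at h
      rwa [pathEdges_reverse x x] at h

/-- The ends of the `p` segments of a closed walk with `p` visits to `x`; one end of each of two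
different segments can be redirected to a new visit to `y`. -/
lemma exists_redirect [DecidableEq α] {x : α} {l : List α} {p : ℕ} (hp : l.count x = p)
    (hp0 : p ≠ 0) (hx : s(x, x) ∉ cycleEdges l) :
    ∃ e : Fin p → Bool → α,
      (∀ u, (cycleEdges l).count s(x, u)
        = (Finset.univ.filter (fun q : Fin p × Bool => e q.1 q.2 = u)).card) ∧
      ∀ a b z w y, a ≠ b → ∃ l', (x :: l').Perm (y :: l) ∧
        cycleEdges l' + ({s(x, e a z)} + {s(x, e b w)})
          = cycleEdges l + ({s(y, e a z)} + {s(y, e b w)}) := by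
  have hmem : x ∈ l := List.count_pos_iff.mp (by omega)
  obtain ⟨ss, hperm, hce, hss⟩ := exists_joinAt hmem
  have hlen : ss.length = p := by rw [← count_joinAt hss, ← hperm.count_eq, hp]
  subst hlen
  -- An empty segment would contribute a loop at `x`.
  have hne : ∀ t ∈ ss, t ≠ [] := by
    rintro t ht rfl
    apply hx
    rw [hce, cycleEdges_joinAt]
    have h₁ := List.single_le_sum (l := ss.map (fun s => pathEdges x s x)) (by simp) _
      (List.mem_map_of_mem ht)
    exact Multiset.mem_of_le h₁ (by simp)
  choose e he₁ he₂ using fun a : Fin ss.length =>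
    exists_segment_ends (hne _ (ss.getElem_mem a.2)) (hss _ (ss.getElem_mem a.2))
  refine ⟨e, fun u => ?_, fun a b z w y hab => ?_⟩
  · rw [hce, cycleEdges_joinAt, ← Fin.sum_univ_fun_getElem, Multiset.count_sum',
      Finset.card_filter, Fintype.sum_prod_type]
    refine Finset.sum_congr rfl fun a _ => ?_
    rw [← Finset.card_filter]
    exact he₁ a u
  · obtain ⟨rest, hrest⟩ := perm_getElem_getElem_cons hab
    obtain ⟨s, hs, hs'⟩ := he₂ a z
    obtain ⟨t, ht, ht'⟩ := he₂ b w
    -- Leave `x` along `s`, pass through `y` between the two redirected ends, return to `x` along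
    -- `t` backwards, then run through the other segments. One visit to `x` has become a visit to
    -- `y`.
    refine ⟨x :: (s ++ y :: (t.reverse ++ joinAt x rest)), ?_, ?_⟩
    · have h₁ := hperm.trans (joinAt_perm hrest)
      refine List.Perm.trans ?_ (h₁.symm.cons y)
      rw [List.perm_iff_count]
      intro c
      have h₂ := hs.count_eq c
      have h₃ := ht.count_eq c
      simp only [joinAt_cons, List.count_cons, List.count_append, List.count_reverse, h₂, h₃,
        Fin.getElem_fin]
      omega
    · have h₁ : cycleEdges l = pathEdges x ss[a] x + pathEdges x ss[b] x
          + (rest.map (fun s => pathEdges x s x)).sum := by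
        rw [hce, cycleEdges_joinAt, (hrest.map _).sum_eq]
        simp [add_assoc]
      have h₂ := hs' y
      have h₃ := ht' y
      rw [cycleEdges_cons, pathEdges_append, pathEdges_append_joinAt, pathEdges_reverse, h₁]
      calc _ = (pathEdges x s y + {s(x, e a z)}) + (pathEdges x t y + {s(x, e b w)})
            + (rest.map (fun s => pathEdges x s x)).sum := by abel
        _ = _ := by rw [h₂, h₃]; simp only [Fin.getElem_fin]; abel

end Walks

end CycleDecomp

namespace CycleDecomp

/-! ### Balanced selections by Hall's theorem -/

section Selection

open Finset

/-- Two maps with equally large fibres differ by a bijection of their domains. -/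
lemma exists_equiv_of_card_fiber {A B S : Type*} [Fintype A] [Fintype B] [DecidableEq S]
    (f : A → S) (h : B → S) (H : ∀ s, #{a | f a = s} = #{b | h b = s}) :
    ∃ e : A ≃ B, ∀ a, h (e a) = f a := by
  have E : ∀ s, Nonempty ({a // f a = s} ≃ {b // h b = s}) := fun s => by
    rw [← Fintype.card_eq, Fintype.card_subtype, Fintype.card_subtype, H]
  refine ⟨(Equiv.sigmaFiberEquiv f).symm.trans
    ((Equiv.sigmaCongrRight fun s => (E s).some).trans (Equiv.sigmaFiberEquiv h)), fun a => ?_⟩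
  exact ((E (f a)).some ⟨a, rfl⟩).2

/-- In a bipartite multigraph all of whose left degrees are `p` and whose right degrees are
`p * b u`, one edge can be selected at each left vertex such that `b u` edges are selected at
each right vertex `u`. -/
lemma exists_transversal {E L U : Type*} [Fintype E] [Fintype L] [Fintype U] [DecidableEq L]
    [DecidableEq U] {p : ℕ} (hp : 0 < p) (l : E → L) (r : E → U) (b : U → ℕ)
    (hl : ∀ a, #{e | l e = a} = p) (hr : ∀ u, #{e | r e = u} = p * b u) :
    ∃ s : L → E, (∀ a, l (s a) = a) ∧ ∀ u, #{a | r (s a) = u} = b u := by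
  classical
  have hσ : ∀ u, #{q : Σ u, Fin (b u) | q.1 = u} = b u := fun u => by
    have : (univ.filter fun q : Σ u, Fin (b u) => q.1 = u) = ({u} : Finset U).sigma fun _ => univ := by
      ext q; simp
    rw [this, card_sigma]; simp
  -- Split each `u` into `b u` copies that receive `p` of its edges each. With `r'` as right end the
  -- multigraph becomes `p`-regular.
  obtain ⟨φ, hφ⟩ := exists_equiv_of_card_fiber r (fun q : (Σ u, Fin (b u)) × Fin p => q.1.1)
    fun u => by
      have : (univ.filter fun q : (Σ u, Fin (b u)) × Fin p => q.1.1 = u)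
          = (univ.filter fun q : Σ u, Fin (b u) => q.1 = u) ×ˢ univ := by ext q; simp
      rw [hr, this, card_product, hσ, card_fin, mul_comm]
  set r' : E → Σ u, Fin (b u) := fun e => (φ e).1 with hr'
  have hr'p : ∀ q, #{e | r' e = q} = p := fun q => by
    have : (univ.filter fun e => r' e = q)
        = (({q} : Finset _) ×ˢ (univ : Finset (Fin p))).map φ.symm.toEmbedding := by
      ext e
      simp only [hr', mem_filter, mem_univ, true_and, mem_map_equiv, Equiv.symm_symm, mem_product,
        mem_singleton, and_true]
    rw [this, card_map, card_product]; simp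
  -- Hall's condition by regularity: the `#A * p` edges at `A` end at neighbours of `A`, which carry
  -- `p` edges each.
  obtain ⟨f, hfi, hft⟩ := (Finset.all_card_le_biUnion_card_iff_exists_injective
    (fun a : L => (univ.filter fun e => l e = a).image r')).1 fun A => by
      have h₁ : #(univ.filter fun e => l e ∈ A) = #A * p := by
        rw [card_eq_sum_card_fiberwise (f := l) (t := A) (fun e he => by simpa using he)]
        rw [sum_const_nat]
        intro a ha
        rw [← hl a]
        congr 1
        ext e
        simp only [mem_filter, mem_univ, true_and, and_iff_right_iff_imp]
        rintro rfl; exact ha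
      have h₂ : #(univ.filter fun e => l e ∈ A)
          ≤ #(A.biUnion fun a => (univ.filter fun e => l e = a).image r') * p := by
        rw [mul_comm]
        refine card_le_mul_card_image_of_maps_to (f := r') (fun e he => ?_) p (fun q _ => ?_)
        · simp only [mem_filter, mem_univ, true_and] at he
          simp only [mem_biUnion, mem_image, mem_filter, mem_univ, true_and]
          exact ⟨_, he, e, rfl, rfl⟩
        · rw [← hr'p q]
          exact card_le_card fun e => by simp
      exact Nat.le_of_mul_le_mul_right (h₁ ▸ h₂) hp
  have hcard : Fintype.card L = Fintype.card (Σ u, Fin (b u)) := by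
    have h₁ : Fintype.card E = Fintype.card L * p := by
      rw [← card_univ (α := E), card_eq_sum_card_fiberwise (f := l) (t := univ) (fun _ _ => by simp)]
      simp [hl]
    have h₂ : Fintype.card E = Fintype.card (Σ u, Fin (b u)) * p := by
      rw [← card_univ (α := E), card_eq_sum_card_fiberwise (f := r') (t := univ) (fun _ _ => by simp)]
      simp [hr'p]
    exact Nat.eq_of_mul_eq_mul_right hp (h₁.symm.trans h₂)
  have hbij : Function.Bijective f := (Fintype.bijective_iff_injective_and_card f).2 ⟨hfi, hcard⟩
  have hs : ∀ a, ∃ e, l e = a ∧ r' e = f a := fun a => by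
    simpa using hft a
  choose s hs₁ hs₂ using hs
  refine ⟨s, hs₁, fun u => ?_⟩
  rw [← hσ u]
  refine card_bij (fun a _ => f a) (fun a ha => ?_) (fun _ _ _ _ h => hfi h) (fun q hq => ?_)
  · simp only [mem_filter, mem_univ, true_and] at ha ⊢
    rw [← hs₂, ← ha, ← hφ]
  · obtain ⟨a, rfl⟩ := hbij.2 q
    refine ⟨a, ?_, rfl⟩
    simp only [mem_filter, mem_univ, true_and] at hq ⊢
    rw [← hq, ← hs₂, ← hφ]

/-- Given `p` segments with two ends each for every colour in `ι`, and `p` edges for every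
factor in `o`, one can select ends of two different segments for each colour and one edge for
each factor such that every vertex occurs `p` times less often than before. -/
lemma exists_balanced_selection {ι o U : Type*} [Fintype ι] [Fintype o] [Fintype U]
    [DecidableEq U] {p : ℕ} (hp : 2 ≤ p) (e : ι → Fin p → Bool → U) (h : o → Fin p → U)
    (b : U → ℕ)
    (H : ∀ u, ∑ i, #{q : Fin p × Bool | e i q.1 q.2 = u} + ∑ j, #{a | h j a = u} = p * b u) :
    ∃ (a a' : ι → Fin p) (z w : ι → Bool) (k : o → Fin p), (∀ i, a i ≠ a' i) ∧
      ∀ u, ∑ i, ((if e i (a i) (z i) = u then 1 else 0) + if e i (a' i) (w i) = u then 1 else 0)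
        + ∑ j, (if h j (k j) = u then 1 else 0) = b u := by
  classical
  -- Left vertices are the segments and the factors. Besides its two real ends, a segment gets `p -
  -- 2` dummy edges, one to each dummy vertex of its colour, so its degree is `p`. Each dummy vertex
  -- also has degree `p` and is to be selected once; hence exactly two segments of each colour
  -- select a real end.
  let r : (ι × Fin p × (Bool ⊕ Fin (p - 2))) ⊕ (o × Fin p) → U ⊕ (ι × Fin (p - 2)) :=
    Sum.elim (fun t => Sum.elim (fun z => Sum.inl (e t.1 t.2.1 z)) (fun d => Sum.inr (t.1, d)) t.2.2)
      (fun t => Sum.inl (h t.1 t.2))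
  let l : (ι × Fin p × (Bool ⊕ Fin (p - 2))) ⊕ (o × Fin p) → (ι × Fin p) ⊕ o :=
    Sum.map (fun t => (t.1, t.2.1)) Prod.fst
  obtain ⟨s, hs, hsb⟩ := exists_transversal (p := p) (by omega) l r (Sum.elim b fun _ => 1)
    (fun q => by
      rw [card_filter, Fintype.sum_sum_type]
      simp only [Fintype.sum_prod_type, l, Sum.map_inl, Sum.map_inr]
      rcases q with ⟨i, a⟩ | j
      · simp [Prod.ext_iff, ite_and]
        omega
      · simp)
    (fun q => by
      rw [card_filter, Fintype.sum_sum_type]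
      simp only [Fintype.sum_prod_type, Fintype.sum_sum_type, r, Sum.elim_inl, Sum.elim_inr]
      rcases q with u | ⟨i, d⟩
      · rw [Sum.elim_inl, ← H u]
        simp only [card_filter, Fintype.sum_prod_type]
        simp
      · simp [Prod.ext_iff, ite_and])
  have hc : ∀ i a, ∃ c, s (Sum.inl (i, a)) = Sum.inl (i, a, c) := fun i a => by
    have := hs (Sum.inl (i, a))
    rcases hq : s (Sum.inl (i, a)) with ⟨i', a', c⟩ | t
    · rw [hq] at this
      simp only [l, Sum.map_inl, Sum.inl.injEq, Prod.mk.injEq] at this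
      obtain ⟨rfl, rfl⟩ := this
      exact ⟨c, rfl⟩
    · rw [hq] at this; simp [l] at this
  have hk : ∀ j, ∃ k, s (Sum.inr j) = Sum.inr (j, k) := fun j => by
    have := hs (Sum.inr j)
    rcases hq : s (Sum.inr j) with t | ⟨j', k⟩
    · rw [hq] at this; simp [l] at this
    · rw [hq] at this
      simp only [l, Sum.map_inr, Sum.inr.injEq] at this
      subst this
      exact ⟨k, rfl⟩
  choose c hc using hc
  choose k hk using hk
  have hdum : ∀ i d, ∑ a, (if c i a = Sum.inr d then 1 else 0) = 1 := fun i d => by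
    have := hsb (Sum.inr (i, d))
    rw [card_filter, Fintype.sum_sum_type] at this
    simp only [Fintype.sum_prod_type, hc, hk, r, Sum.elim_inl, Sum.elim_inr] at this
    have hD : ∀ (i' : ι) (x : Fin p),
        (Sum.elim (fun z => Sum.inl (e i' x z)) (fun d => Sum.inr (i', d)) (c i' x)
          = (Sum.inr (i, d) : U ⊕ (ι × Fin (p - 2)))) ↔ (i' = i ∧ c i' x = Sum.inr d) := by
      intro i' x
      rcases c i' x with v | d' <;> simp
    simp only [hD, ite_and] at this
    simpa [Finset.sum_ite_eq'] using this
  -- Of the `p` segments of colour `i`, exactly `p - 2` are used up by the dummy vertices.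
  have htwo : ∀ i, #{a | (c i a).isLeft = true} = 2 := fun i => by
    have h₁ : ∀ x, (if (c i x).isLeft = true then 1 else 0)
        + ∑ d, (if c i x = Sum.inr d then 1 else 0) = 1 := fun x => by
      rcases c i x with v | d <;> simp
    have h₂ := Finset.sum_congr (rfl : (univ : Finset (Fin p)) = univ) fun x _ => h₁ x
    rw [sum_add_distrib, sum_comm, ← card_filter] at h₂
    simp only [hdum] at h₂
    simp at h₂
    omega
  choose a a' hne haa using fun i => card_eq_two.1 (htwo i)
  have hz : ∀ i, ∃ z, c i (a i) = Sum.inl z := fun i => by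
    have : a i ∈ univ.filter fun x => (c i x).isLeft = true := by rw [haa]; simp
    simpa [Sum.isLeft_iff] using this
  have hw : ∀ i, ∃ z, c i (a' i) = Sum.inl z := fun i => by
    have : a' i ∈ univ.filter fun x => (c i x).isLeft = true := by rw [haa]; simp
    simpa [Sum.isLeft_iff] using this
  choose z hz using hz
  choose w hw using hw
  refine ⟨a, a', z, w, k, hne, fun u => ?_⟩
  have := hsb (Sum.inl u)
  rw [card_filter, Fintype.sum_sum_type] at this
  simp only [Fintype.sum_prod_type, hc, hk, r, Sum.elim_inl, Sum.elim_inr] at this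
  rw [← this]
  congr 1
  · refine sum_congr rfl fun i _ => ?_
    rw [← sum_subset (subset_univ {a i, a' i}), sum_pair (hne i)]
    · simp [hz, hw]
    · intro x _ hx
      rw [← haa] at hx
      simp only [mem_filter, mem_univ, true_and] at hx
      rcases hq : c i x with v | d
      · simp [hq] at hx
      · simp
  · simp

end Selection

end CycleDecomp

namespace CycleDecomp

/-! ### Weighted detachments and the splitting of vertices -/

section Detachment

open Finset

lemma mem_of_mem_pathEdges {α : Type*} {x a b : α} {s : Sym2 α} {l : List α}
    (h : s ∈ pathEdges a l b) (hx : x ∈ s) : x ∈ a :: l ∨ x = b := by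
  induction l generalizing a with
  | nil =>
    rw [pathEdges_nil, Multiset.mem_singleton] at h
    subst h
    simpa using hx
  | cons c l ih =>
    rw [pathEdges_cons, Multiset.mem_cons] at h
    rcases h with rfl | h
    · rcases Sym2.mem_iff.1 hx with rfl | rfl <;> simp
    · rcases ih h with h | h
      · exact Or.inl (List.mem_cons_of_mem _ h)
      · exact Or.inr h

lemma mem_of_mem_cycleEdges {α : Type*} {x : α} {s : Sym2 α} {l : List α}
    (h : s ∈ cycleEdges l) (hx : x ∈ s) : x ∈ l := by
  cases l with
  | nil => simp at h
  | cons a l =>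
    rcases mem_of_mem_pathEdges h hx with h | rfl
    · exact h
    · simp

lemma count_map_sym2_mk {α : Type*} [DecidableEq α] (S : Multiset α) (x a b : α) :
    (S.map fun u => s(x, u)).count s(a, b)
      = if a = x then S.count b else if b = x then S.count a else 0 := by
  have hinj : Function.Injective fun u => s(x, u) := fun u v h => Sym2.congr_right.1 h
  split_ifs with h₁ h₂
  · subst h₁; exact Multiset.count_map_eq_count' _ S hinj b
  · subst h₂; rw [Sym2.eq_swap]; exact Multiset.count_map_eq_count' _ S hinj a
  · rw [Multiset.count_eq_zero, Multiset.mem_map]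
    rintro ⟨u, -, hu⟩
    rcases Sym2.eq_iff.1 hu with h | h
    · exact h₁ h.1.symm
    · exact h₂ h.1.symm

/-- The neighbours of `x` along the edges in `M`. -/
lemma exists_neighbours {α : Type*} [DecidableEq α] {x : α} {M : Multiset (Sym2 α)} {p : ℕ}
    (hp : (M.filter (x ∈ ·)).card = p) :
    ∃ h : Fin p → α, ∀ u, M.count s(x, u) = #{a | h a = u} := by
  have : ∀ F : Multiset (Sym2 α), (∀ s ∈ F, x ∈ s) → ∃ l : List α, F = (l : Multiset α).map (s(x, ·)) := by
    intro F
    induction F using Multiset.induction with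
    | empty => exact fun _ => ⟨[], rfl⟩
    | cons s F ih =>
      intro h
      obtain ⟨l, hl⟩ := ih fun t ht => h t (Multiset.mem_cons_of_mem ht)
      obtain ⟨u, rfl⟩ := h s (Multiset.mem_cons_self s F)
      exact ⟨u :: l, by rw [hl]; rfl⟩
  obtain ⟨l, hl⟩ := this _ fun s hs => (Multiset.mem_filter.1 hs).2
  have hlen : l.length = p := by
    rw [hl, Multiset.card_map] at hp
    simpa using hp
  subst hlen
  refine ⟨l.get, fun u => ?_⟩
  have h₁ : (M.filter (x ∈ ·)).count s(x, u) = M.count s(x, u) :=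
    Multiset.count_filter_of_pos (by simp)
  rw [← h₁, hl, count_map_sym2_mk, if_pos rfl]
  conv_lhs => rw [← List.ofFn_get l, ← Fin.univ_val_map, Multiset.count_map]
  rw [card_def, filter_val]
  congr 1
  exact Multiset.filter_congr fun a _ => eq_comm

variable {W J κ o : Type*} [DecidableEq W] [DecidableEq J] [Fintype κ] [Fintype o]

/-- Closed walks `L i` and factors `M j` form a detachment with weights `g`: each walk visits
each vertex over its vertex set `A i` exactly `g` times, each factor has degree `g`, and every
pair of vertices `x`, `y` in different parts is joined by `lam * g x * g y` edges. -/
structure IsDetachment (lam : ℕ) (π : W → J) (A : κ → Finset J) (g : W → ℕ)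
    (L : κ → List W) (M : o → Multiset (Sym2 W)) : Prop where
  count_walk : ∀ i x, (L i).count x = if π x ∈ A i then g x else 0
  card_factor : ∀ j x, ((M j).filter (x ∈ ·)).card = g x
  count_total : ∀ x y, (∑ i, cycleEdges (L i) + ∑ j, M j).count s(x, y)
    = if π x = π y then 0 else lam * g x * g y

/-- One unit of the weight of `x` can be moved to a vertex `y` of weight zero in the same part. -/
lemma IsDetachment.exists_split [Fintype W] {lam : ℕ} {π : W → J} {A : κ → Finset J} {g : W → ℕ}
    {L : κ → List W} {M : o → Multiset (Sym2 W)} (H : IsDetachment lam π A g L M) {x y : W}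
    (hxy : π x = π y) (hx : 2 ≤ g x) (hy : g y = 0) :
    ∃ (L' : κ → List W) (M' : o → Multiset (Sym2 W)),
      IsDetachment lam π A (fun v => if v = x then g x - 1 else if v = y then 1 else g v) L' M' := by
  have hne : x ≠ y := by rintro rfl; omega
  have hloop : ∀ v, π v = π x → s(x, v) ∉ ∑ i, cycleEdges (L i) + ∑ j, M j := fun v hv => by
    rw [← Multiset.count_eq_zero, H.count_total, if_pos hv.symm]
  have hloopL : ∀ i, s(x, x) ∉ cycleEdges (L i) := fun i h =>
    hloop x rfl (Multiset.mem_add.2 (Or.inl (Multiset.mem_sum.2 ⟨i, mem_univ _, h⟩)))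
  have hloopM : ∀ j v, π v = π x → s(x, v) ∉ M j := fun j v hv h =>
    hloop v hv (Multiset.mem_add.2 (Or.inr (Multiset.mem_sum.2 ⟨j, mem_univ _, h⟩)))
  choose e he hre using fun i : {i // π x ∈ A i} =>
    exists_redirect (p := g x) (by rw [H.count_walk, if_pos i.2]) (by omega) (hloopL i)
  choose h hh using fun j : o => exists_neighbours (H.card_factor j x)
  -- With `p = g x`, the `lam * g x * g u` edges between `x` and a vertex `u` of another part number
  -- `p * (lam * g u)`. Walks that avoid the part of `x` contribute none of them.
  obtain ⟨a, a', z, w, k, haa, hsel⟩ := exists_balanced_selection hx e h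
    (fun u => if π x = π u then 0 else lam * g u) fun u => by
      have h₁ := H.count_total x u
      rw [Multiset.count_add, Multiset.count_sum', Multiset.count_sum',
        ← Fintype.sum_subtype_add_sum_subtype (fun i => π x ∈ A i)] at h₁
      have h₂ : ∑ i : {i // ¬ π x ∈ A i}, (cycleEdges (L i)).count s(x, u) = 0 :=
        sum_eq_zero fun i _ => Multiset.count_eq_zero.2 fun hm => by
          have := List.count_pos_iff.2 (mem_of_mem_cycleEdges hm (Sym2.mem_mk_left x u))
          rw [H.count_walk, if_neg i.2] at this
          exact absurd this (lt_irrefl 0)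
      rw [h₂, add_zero] at h₁
      simp only [← he, ← hh, h₁]
      split_ifs <;> ring
  -- `S₁ i` holds the far ends of the edges that walk `i` moves from `x` to `y`; `S` collects those
  -- of all walks and factors.
  let S₁ : κ → Multiset W := fun i => if hi : π x ∈ A i then
    {e ⟨i, hi⟩ (a ⟨i, hi⟩) (z ⟨i, hi⟩)} + {e ⟨i, hi⟩ (a' ⟨i, hi⟩) (w ⟨i, hi⟩)} else 0
  let S : Multiset W := ∑ i, S₁ i + ∑ j, {h j (k j)}
  have hS : ∀ u, S.count u = if π x = π u then 0 else lam * g u := fun u => by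
    rw [← hsel u, Multiset.count_add, Multiset.count_sum', Multiset.count_sum',
      ← Fintype.sum_subtype_add_sum_subtype (fun i => π x ∈ A i)]
    have h₂ : ∑ i : {i // ¬ π x ∈ A i}, (S₁ i).count u = 0 :=
      sum_eq_zero fun i _ => by simp [S₁, i.2]
    rw [h₂, add_zero]
    congr 1
    · refine sum_congr rfl fun i _ => ?_
      simp only [S₁, dif_pos i.2, Multiset.count_add, Multiset.count_singleton,
        eq_comm (a := u)]
    · refine sum_congr rfl fun i _ => ?_
      simp [Multiset.count_singleton, eq_comm]
  have hL : ∀ i, ∃ l' : List W, (∀ c, l'.count c = if π c ∈ A i then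
        (if c = x then g x - 1 else if c = y then 1 else g c) else 0) ∧
      cycleEdges l' + (S₁ i).map (s(x, ·)) = cycleEdges (L i) + (S₁ i).map (s(y, ·)) := fun i => by
    by_cases hi : π x ∈ A i
    · obtain ⟨l', h₁, h₂⟩ := hre ⟨i, hi⟩ (a ⟨i, hi⟩) (a' ⟨i, hi⟩) (z ⟨i, hi⟩) (w ⟨i, hi⟩) y (haa _)
      refine ⟨l', fun c => ?_, by simpa [S₁, hi] using h₂⟩
      have h₃ := h₁.count_eq c
      rw [List.count_cons, List.count_cons, H.count_walk] at h₃
      by_cases hcx : c = x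
      · subst hcx
        simp [hi, hne.symm] at h₃ ⊢
        omega
      · by_cases hcy : c = y
        · subst hcy
          simp [← hxy, hi, hne, hcx, hy] at h₃ ⊢
          omega
        · simpa [hcx, hcy, Ne.symm hcx, Ne.symm hcy] using h₃
    · refine ⟨L i, fun c => ?_, by simp [S₁, hi]⟩
      rw [H.count_walk]
      split_ifs with h₁ h₂ h₃
      · subst h₂; exact absurd h₁ hi
      · subst h₃; exact absurd (hxy ▸ h₁) hi
      · rfl
      · rfl
  have hM : ∀ j, ∃ M' : Multiset (Sym2 W), (∀ c, (M'.filter (c ∈ ·)).card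
        = if c = x then g x - 1 else if c = y then 1 else g c) ∧
      M' + {s(x, h j (k j))} = M j + {s(y, h j (k j))} := fun j => by
    have hmem : s(x, h j (k j)) ∈ M j := by
      rw [← Multiset.count_pos, hh, card_pos]
      exact ⟨k j, by simp⟩
    -- The far end is neither `x` nor `y`, so the exchange changes degrees only at `x` and `y`.
    have hπ : π (h j (k j)) ≠ π x := fun h' => hloopM j _ h' hmem
    have heq : (M j).erase s(x, h j (k j)) + {s(y, h j (k j))} + {s(x, h j (k j))}
        = M j + {s(y, h j (k j))} := by
      conv_rhs => rw [← Multiset.cons_erase hmem, ← Multiset.singleton_add]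
      abel
    refine ⟨_, fun c => ?_, heq⟩
    have h₁ := congrArg (fun N => (N.filter (c ∈ ·)).card) heq
    simp only [Multiset.filter_add, Multiset.card_add, Multiset.filter_singleton, Sym2.mem_iff,
      H.card_factor] at h₁
    simp only [Multiset.filter_add, Multiset.card_add, Multiset.filter_singleton, Sym2.mem_iff]
    have hux : h j (k j) ≠ x := fun h' => hπ (by rw [h'])
    have huy : h j (k j) ≠ y := fun h' => hπ (by rw [h', hxy])
    by_cases hcx : c = x
    · subst hcx
      simp [hne, hux.symm] at h₁ ⊢
      omega
    · by_cases hcy : c = y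
      · subst hcy
        simp [hne.symm, huy.symm, hy] at h₁ ⊢
        omega
      · simp only [hcx, hcy, false_or, if_false] at h₁ ⊢
        split_ifs at h₁ ⊢ <;> simp at h₁ ⊢ <;> omega
  choose L' hL₁ hL₂ using hL
  choose M' hM₁ hM₂ using hM
  refine ⟨L', M', hL₁, hM₁, fun c d => ?_⟩
  -- Stated additively to avoid subtraction of multisets. By `hS`, each `u` outside the part loses
  -- `lam * g u` edges to `x` and gains as many to `y`, as the new weights `g x - 1` and `1`
  -- require.
  have hT : (∑ i, cycleEdges (L' i) + ∑ j, M' j) + S.map (s(x, ·))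
      = (∑ i, cycleEdges (L i) + ∑ j, M j) + S.map (s(y, ·)) := by
    have h₁ := sum_congr (rfl : (univ : Finset κ) = univ) fun i _ => hL₂ i
    have h₂ := sum_congr (rfl : (univ : Finset o) = univ) fun j _ => hM₂ j
    rw [sum_add_distrib, sum_add_distrib] at h₁ h₂
    have h₃ : ∀ v, S.map (s(v, ·)) = ∑ i, (S₁ i).map (s(v, ·)) + ∑ j, {s(v, h j (k j))} := by
      intro v
      change Multiset.mapAddMonoidHom (s(v, ·)) S = _
      rw [map_add, map_sum, map_sum]
      rfl
    rw [h₃, h₃, add_add_add_comm, h₁, h₂, add_add_add_comm]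
  have h₁ := congrArg (Multiset.count s(c, d)) hT
  rw [Multiset.count_add, Multiset.count_add _ _ (S.map _), count_map_sym2_mk, count_map_sym2_mk,
    H.count_total, hS, hS] at h₁
  by_cases hcd : π c = π d
  · grind
  · rw [if_neg hcd] at h₁ ⊢
    have hcd' : c ≠ d := fun h => hcd (by rw [h])
    obtain ⟨q, hq⟩ : ∃ q, g x = q + 1 := ⟨g x - 1, by omega⟩
    by_cases hcx : c = x
    · subst hcx
      have h₂ : d ≠ y := fun h => hcd (by rw [h, hxy])
      simp only [if_true, hcd, if_false, hne, Ne.symm hcd', h₂, hq, Nat.add_sub_cancel] at h₁ ⊢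
      linarith [show lam * (q + 1) * g d = lam * q * g d + lam * g d by ring]
    by_cases hdx : d = x
    · subst hdx
      have h₂ : c ≠ y := fun h => hcd (by rw [h, hxy])
      simp only [if_true, Ne.symm hcd, if_false, hne, hcx, h₂, hq, Nat.add_sub_cancel] at h₁ ⊢
      linarith [show lam * g c * (q + 1) = lam * g c * q + lam * g c by ring]
    by_cases hcy : c = y
    · subst hcy
      simp only [if_true, hxy, hcd, if_false, hcx, hdx, Ne.symm hcd', hy] at h₁ ⊢
      linarith
    by_cases hdy : d = y
    · subst hdy
      simp only [if_true, hxy, Ne.symm hcd, if_false, hcx, hdx, hcy, hy] at h₁ ⊢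
      linarith
    simpa only [hcx, hdx, hcy, hdy, if_false, add_zero] using h₁

/-- The weights average one on each part, so a vertex of weight zero forces one of weight at least
two in its part. Splitting keeps the average and lowers the number of zeros; without zeros all
weights are one. -/
lemma IsDetachment.exists_one [Fintype W] {lam m : ℕ} {π : W → J} {A : κ → Finset J}
    (hπ : ∀ j, #{x | π x = j} = m) {g : W → ℕ} (hg : ∀ j, ∑ x with π x = j, g x = m)
    {L : κ → List W} {M : o → Multiset (Sym2 W)} (H : IsDetachment lam π A g L M) :
    ∃ (L' : κ → List W) (M' : o → Multiset (Sym2 W)), IsDetachment lam π A 1 L' M' := by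
  induction hN : #{x | g x = 0} using Nat.strong_induction_on generalizing g L M with
  | _ N ih =>
  by_cases h0 : ∃ y, g y = 0
  · obtain ⟨y, hy⟩ := h0
    obtain ⟨x, hx, hgx⟩ : ∃ x, π x = π y ∧ 2 ≤ g x := by
      by_contra! hcon
      have : ∑ x with π x = π y, g x < ∑ x with π x = π y, 1 :=
        sum_lt_sum (fun x hx => Nat.le_of_lt_succ (hcon x (by simpa using hx)))
          ⟨y, by simp, by omega⟩
      rw [hg, sum_const, hπ] at this
      simp at this
    have hne : x ≠ y := by rintro rfl; omega
    obtain ⟨L', M', H'⟩ := H.exists_split hx hgx hy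
    refine ih _ ?_ (fun j => ?_) H' rfl
    · rw [← hN]
      refine card_lt_card ((ssubset_iff_of_subset fun v => ?_).2 ⟨y, by simp [hy], ?_⟩)
      · simp only [mem_filter, mem_univ, true_and]
        split_ifs with h₁ h₂
        · intro h; omega
        · exact False.elim
        · exact id
      · simp [hne.symm]
    · have h₁ : ∀ v, (if v = x then g x - 1 else if v = y then 1 else g v) + (if v = x then 1 else 0)
          = g v + if v = y then 1 else 0 := by
        intro v
        by_cases hvx : v = x
        · subst hvx; simp [hne]; omega
        · by_cases hvy : v = y
          · subst hvy; simp [hvx, hy]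
          · simp [hvx, hvy]
      have h₂ := sum_congr (rfl : univ.filter (fun v => π v = j) = _) fun v _ => h₁ v
      rw [sum_add_distrib, sum_add_distrib, hg] at h₂
      simp only [sum_ite_eq', mem_filter, mem_univ, true_and, hx] at h₂
      omega
  · push Not at h0
    have : g = 1 := by
      funext y
      by_contra hy
      have : ∑ x with π x = π y, 1 < ∑ x with π x = π y, g x :=
        sum_lt_sum (fun x _ => Nat.pos_of_ne_zero (h0 x)) ⟨y, by simp, by
          have := h0 y
          simp only [Pi.one_apply] at hy
          omega⟩
      rw [hg, sum_const, hπ] at this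
      simp at this
    subst this
    exact ⟨L, M, H⟩

lemma cycleEdges_map {α β : Type*} (f : α → β) (l : List α) :
    cycleEdges (l.map f) = (cycleEdges l).map (Sym2.map f) := by
  have : ∀ (l : List α) a b, pathEdges (f a) (l.map f) (f b) = (pathEdges a l b).map (Sym2.map f) := by
    intro l
    induction l with
    | nil => simp
    | cons c l ih => simp [ih]
  cases l with
  | nil => rfl
  | cons a l => exact this l a a

/-- Cycles `l i` and `1`-factors `M j` that together cover each pair of elements of `J` exactly
`lam * m` times lift to cycles and `1`-factors on `W` that together cover each pair in
different fibres of `π` exactly `lam` times. -/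
theorem exists_detachment [Fintype W] {lam m : ℕ} (hm : 0 < m) {π : W → J}
    (hπ : ∀ j, #{x | π x = j} = m) {l : κ → List J} (hl : ∀ i, (l i).Nodup)
    {M : o → Multiset (Sym2 J)} (hM : ∀ j v, ((M j).filter (v ∈ ·)).card = 1)
    (hT : ∀ u v, (∑ i, cycleEdges (l i) + ∑ j, M j).count s(u, v)
      = if u = v then 0 else lam * m) :
    ∃ (L' : κ → List W) (M' : o → Multiset (Sym2 W)),
      IsDetachment lam π (fun i => (l i).toFinset) 1 L' M' := by
  have hrep : ∀ j, ∃ x, π x = j := fun j => by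
    have : 0 < #{x | π x = j} := by rw [hπ]; exact hm
    obtain ⟨x, hx⟩ := card_pos.1 this
    exact ⟨x, by simpa using hx⟩
  choose r hr using hrep
  have hinj : Function.Injective r := fun a b h => by rw [← hr a, ← hr b, h]
  -- The fully amalgamated start: the representative `r j` carries the whole weight of its part,
  -- cycles are traversed `m` times and factor edges repeated `m` times.
  refine IsDetachment.exists_one hπ (g := fun x => if x = r (π x) then m else 0)
    (L := fun i => (List.replicate m ((l i).map r)).flatten)
    (M := fun j => m • (M j).map (Sym2.map r)) (fun j => ?_) ⟨fun i x => ?_, fun j x => ?_, fun x y => ?_⟩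
  · rw [sum_eq_single (r j)]
    · simp [hr]
    · intro x hx hne
      simp only [mem_filter, mem_univ, true_and] at hx
      rw [if_neg (by rwa [hx])]
    · simp [hr]
  · rw [List.count_flatten, List.map_replicate, List.sum_replicate, smul_eq_mul]
    by_cases hx : x = r (π x)
    · rw [if_pos hx]
      conv_lhs => rw [hx, List.count_map_of_injective _ _ hinj]
      split_ifs with h
      · rw [List.count_eq_one_of_mem (hl i) (by simpa using h), mul_one]
      · rw [List.count_eq_zero_of_not_mem (by simpa using h), mul_zero]
    · rw [if_neg hx, ite_self, List.count_eq_zero_of_not_mem, mul_zero]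
      rintro h
      obtain ⟨j, -, rfl⟩ := List.mem_map.1 h
      exact hx (by rw [hr])
  · rw [Multiset.filter_nsmul, Multiset.card_nsmul, Multiset.filter_map, Multiset.card_map]
    by_cases hx : x = r (π x)
    · rw [if_pos hx]
      conv_rhs => rw [← mul_one m, ← hM j (π x)]
      congr 2
      refine Multiset.filter_congr fun s _ => ?_
      conv_lhs => rw [hx]
      simp only [Function.comp_apply, Sym2.mem_map]
      exact ⟨fun ⟨a, ha, h⟩ => hinj h ▸ ha, fun h => ⟨_, h, rfl⟩⟩
    · rw [if_neg hx, Multiset.filter_eq_nil.2, Multiset.card_zero, mul_zero]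
      intro s _ h
      obtain ⟨a, -, rfl⟩ := Sym2.mem_map.1 h
      exact hx (by rw [hr])
  · have h₁ : ∑ i, cycleEdges (List.replicate m ((l i).map r)).flatten
        + ∑ j, m • (M j).map (Sym2.map r)
        = m • (∑ i, cycleEdges (l i) + ∑ j, M j).map (Sym2.map r) := by
      simp only [cycleEdges_flatten_replicate, cycleEdges_map]
      change _ = m • Multiset.mapAddMonoidHom (Sym2.map r) _
      rw [map_add, map_sum, map_sum, smul_add, smul_sum, smul_sum]
      rfl
    rw [h₁, Multiset.count_nsmul]
    by_cases hx : x = r (π x)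
    · by_cases hy : y = r (π y)
      · have h₂ : s(x, y) = Sym2.map r s(π x, π y) := by rw [Sym2.map_mk, ← hx, ← hy]
        rw [if_pos hx, if_pos hy, h₂, Multiset.count_map_eq_count' _ _ (Sym2.map.injective hinj), hT]
        split_ifs
        · rfl
        · ring
      · rw [Multiset.count_eq_zero_of_notMem, if_neg hy]
        · simp
        · rw [Multiset.mem_map]
          rintro ⟨t, -, ht⟩
          obtain ⟨a, -, ha⟩ := Sym2.mem_map.1 (ht ▸ Sym2.mem_mk_right x y)
          exact hy (by rw [← ha, hr])
    · rw [Multiset.count_eq_zero_of_notMem, if_neg hx]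
      · simp
      · rw [Multiset.mem_map]
        rintro ⟨t, -, ht⟩
        obtain ⟨a, -, ha⟩ := Sym2.mem_map.1 (ht ▸ Sym2.mem_mk_left x y)
        exact hx (by rw [← ha, hr])

end Detachment

end CycleDecomp

namespace CycleDecomp

/-! ### Translation between multigraphs with labelled edges and multisets of pairs -/

section Graphs

open Finset

variable {α : Type*} {N : ℕ} {G : SimpleGraph α} {H : Graph α (Sym2 α × Fin N)}

lemma mem_edgeSet_foldGraph {e : Sym2 α × Fin N} :
    e ∈ (foldGraph N G).edgeSet ↔ e.1 ∈ G.edgeSet := by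
  change (∃ x y, G.Adj x y ∧ e.1 = s(x, y)) ↔ _
  obtain ⟨s, t⟩ := e
  induction s using Sym2.ind with
  | _ a b =>
    rw [SimpleGraph.mem_edgeSet]
    refine ⟨?_, fun h => ⟨a, b, h, rfl⟩⟩
    rintro ⟨x, y, h, h'⟩
    rcases Sym2.eq_iff.1 h' with ⟨h₁, h₂⟩ | ⟨h₁, h₂⟩ <;> subst h₁ h₂
    · exact h
    · exact h.symm

lemma isLink_iff_of_le (hH : H ≤ foldGraph N G) {e : Sym2 α × Fin N} {x y : α} :
    H.IsLink e x y ↔ e ∈ H.edgeSet ∧ e.1 = s(x, y) := by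
  refine ⟨fun h => ⟨h.edge_mem, (h.mono hH).2⟩, fun ⟨h, h'⟩ => ?_⟩
  obtain ⟨a, b, hab⟩ := H.exists_isLink_of_mem_edgeSet h
  rcases Sym2.eq_iff.1 (h'.symm.trans (hab.mono hH).2) with ⟨rfl, rfl⟩ | ⟨rfl, rfl⟩
  · exact hab
  · exact hab.symm

lemma exists_le_foldGraph {X : Set α} {F : Set (Sym2 α × Fin N)}
    (hF : F ⊆ (foldGraph N G).edgeSet) (hX : ∀ e ∈ F, ∀ x ∈ e.1, x ∈ X) :
    ∃ H ≤ foldGraph N G, H.vertexSet = X ∧ H.edgeSet = F := by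
  refine ⟨((foldGraph N G).restrict F).induce X, ⟨fun _ _ => Set.mem_univ _, fun e x y h => h.1.2⟩,
    rfl, ?_⟩
  ext e
  refine ⟨?_, fun he => ?_⟩
  · rintro ⟨x, y, h⟩
    exact h.1.1
  · obtain ⟨x, y, h⟩ := hF he
    exact ⟨x, y, ⟨he, h⟩, hX e he x (by rw [h.2]; simp), hX e he y (by rw [h.2]; simp)⟩

variable [Finite α]

/-- The multiset of the pairs of ends of the edges in `F`. -/
noncomputable def endsMultiset (F : Set (Sym2 α × Fin N)) : Multiset (Sym2 α) :=
  (Set.toFinite F).toFinset.val.map Prod.fst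

lemma mem_endsMultiset {F : Set (Sym2 α × Fin N)} {s : Sym2 α} :
    s ∈ endsMultiset F ↔ ∃ t, (s, t) ∈ F := by
  simp [endsMultiset]

lemma count_endsMultiset [DecidableEq α] (F : Set (Sym2 α × Fin N)) (s : Sym2 α) :
    (endsMultiset F).count s = {t | (s, t) ∈ F}.ncard := by
  rw [endsMultiset, Multiset.count_map, ← Finset.filter_val, ← card_def, ← Set.ncard_coe_finset,
    ← Set.ncard_image_of_injective {t | (s, t) ∈ F} (Prod.mk_right_injective s)]
  congr 1
  ext ⟨a, t⟩
  simp only [coe_filter, Set.Finite.mem_toFinset, Set.mem_ofPred_eq, Set.mem_image, Prod.mk.injEq]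
  constructor
  · rintro ⟨h, rfl⟩; exact ⟨t, h, rfl, rfl⟩
  · rintro ⟨t', h, rfl, rfl⟩; exact ⟨h, rfl⟩

lemma card_filter_endsMultiset [DecidableEq α] (F : Set (Sym2 α × Fin N)) (x : α) :
    ((endsMultiset F).filter (x ∈ ·)).card = {e | e ∈ F ∧ x ∈ e.1}.ncard := by
  rw [endsMultiset, Multiset.filter_map, Multiset.card_map, ← Finset.filter_val, ← card_def,
    ← Set.ncard_coe_finset]
  congr 1
  ext e
  simp

lemma degree_eq_of_le [DecidableEq α] (hH : H ≤ foldGraph N G) (x : α) :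
    degree H x = ((endsMultiset H.edgeSet).filter (x ∈ ·)).card := by
  have h₁ : H.loopSet x = ∅ := by
    ext e
    simp only [Set.mem_empty_iff_false, iff_false]
    exact fun h => ((Graph.IsLink.mono hH h).1).ne rfl
  rw [degree, h₁, Set.ncard_empty, add_zero, card_filter_endsMultiset]
  congr 1
  ext e
  refine ⟨fun ⟨y, h⟩ => ⟨h.edge_mem, ?_⟩, fun ⟨h, y, hy⟩ => ⟨y, (isLink_iff_of_le hH).2 ⟨h, hy⟩⟩⟩
  rw [((isLink_iff_of_le hH).1 h).2]
  simp

lemma isOneFactor_iff_of_le [DecidableEq α] (hH : H ≤ foldGraph N G) (hV : H.vertexSet = Set.univ) :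
    IsOneFactor H (foldGraph N G) ↔
      ∀ x, ((endsMultiset H.edgeSet).filter (x ∈ ·)).card = 1 := by
  simp only [← degree_eq_of_le hH]
  exact ⟨fun h x => h.2 x (Set.mem_univ x), fun h => ⟨⟨hH, hV⟩, fun x _ => h x⟩⟩

lemma IsCycle.exists_list (hH : H ≤ foldGraph N G) (hc : IsCycle H) :
    ∃ l : List α, l.Nodup ∧ 2 ≤ l.length ∧ (∀ x, x ∈ H.vertexSet ↔ x ∈ l) ∧
      endsMultiset H.edgeSet = cycleEdges l := by
  obtain ⟨c, hc, v, e, hv, he, hV, hE, hlink⟩ := hc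
  obtain ⟨n, rfl⟩ : ∃ n, c = n + 1 := ⟨c - 1, by omega⟩
  -- `ZMod (n + 1)` unfolds to `Fin (n + 1)`, with the same cyclic successor.
  change Fin (n + 1) → α at v
  change Fin (n + 1) → Sym2 α × Fin N at e
  refine ⟨List.ofFn v, List.nodup_ofFn.2 hv, by simpa using hc, fun x => ?_, ?_⟩
  · rw [hV, List.mem_ofFn]; rfl
  · have h₁ : (Set.toFinite H.edgeSet).toFinset = univ.map ⟨e, he⟩ := by
      ext t
      rw [Set.Finite.mem_toFinset, hE, mem_map]
      simp only [mem_univ, true_and]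
      rfl
    rw [cycleEdges_ofFn, endsMultiset, h₁, map_val, Multiset.map_map]
    exact Multiset.map_congr rfl fun t _ => ((isLink_iff_of_le hH).1 (hlink t)).2

/-- Equal multiplicities allow the steps of the closed walk to be matched bijectively with the edges
of `H`. This also covers length two, where both steps have the same pair of ends and receive
different parallel edges. -/
lemma isCycle_of_list (hH : H ≤ foldGraph N G) {l : List α} (hl : l.Nodup) (hl2 : 2 ≤ l.length)
    (hV : ∀ x, x ∈ H.vertexSet ↔ x ∈ l) (hE : endsMultiset H.edgeSet = cycleEdges l) :
    IsCycle H := by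
  classical
  obtain ⟨n, hn⟩ : ∃ n, l.length = n + 1 := ⟨l.length - 1, by omega⟩
  obtain ⟨v, rfl⟩ : ∃ v : Fin (n + 1) → α, l = List.ofFn v :=
    ⟨fun i => l.get (i.cast hn.symm), by
      apply List.ext_getElem
      · simp [hn]
      · intro i h₁ h₂
        rw [List.getElem_ofFn]
        rfl⟩
  rw [cycleEdges_ofFn] at hE
  have := Fintype.ofFinite α
  have := Fintype.ofFinite H.edgeSet
  obtain ⟨e, he⟩ := exists_equiv_of_card_fiber (fun t => s(v t, v (t + 1)))
    (fun e : H.edgeSet => e.1.1) fun s => by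
      have h₁ := congrArg (Multiset.count s) hE
      rw [endsMultiset, Multiset.count_map, Multiset.count_map, ← filter_val, ← filter_val,
        ← card_def, ← card_def] at h₁
      simp only [eq_comm (a := s)] at h₁
      rw [← h₁, ← card_map (Function.Embedding.subtype _)]
      congr 1
      ext e
      simp only [mem_filter, Set.Finite.mem_toFinset, mem_map, mem_univ, true_and]
      exact ⟨fun h => ⟨⟨e, h.1⟩, h.2, rfl⟩, by rintro ⟨e', h, rfl⟩; exact ⟨e'.2, h⟩⟩
  refine ⟨n + 1, by simpa using hl2, v, fun t => (e t).1, List.nodup_ofFn.1 hl,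
    Subtype.val_injective.comp e.injective, ?_, ?_, fun t => ?_⟩
  · ext x
    rw [hV, List.mem_ofFn]; rfl
  · ext d
    exact ⟨fun h => ⟨e.symm ⟨d, h⟩, by simp⟩, by rintro ⟨t, rfl⟩; exact (e t).2⟩
  · exact (isLink_iff_of_le hH).2 ⟨(e t).2, he t⟩

variable {K : Type*}

lemma IsDecomposition.comp_equiv {α β K' : Type*} {G : Graph α β} {H : K → Graph α β}
    (h : IsDecomposition G H) (e : K' ≃ K) : IsDecomposition G (fun k => H (e k)) :=
  ⟨fun k => h.1 _, fun _ _ hne => h.2.1 (e.injective.ne hne), by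
    rw [← h.2.2]
    exact e.surjective.iUnion_comp fun k => (H k).edgeSet⟩

lemma IsDecomposition.count_sum [DecidableEq α] [Fintype K]
    {H : K → Graph α (Sym2 α × Fin N)} (h : IsDecomposition (foldGraph N G) H) (s : Sym2 α)
    [Decidable (s ∈ G.edgeSet)] :
    (∑ k, endsMultiset (H k).edgeSet).count s = if s ∈ G.edgeSet then N else 0 := by
  classical
  rw [Multiset.count_sum']
  simp only [count_endsMultiset]
  rw [← finsum_eq_sum_of_fintype, ← Set.ncard_iUnion_of_finite (fun _ => Set.toFinite _)]
  · have : (⋃ k, {t | (s, t) ∈ (H k).edgeSet}) = {t : Fin N | s ∈ G.edgeSet} := by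
      ext t
      have h₁ : (s, t) ∈ ⋃ k, (H k).edgeSet ↔ s ∈ G.edgeSet := by
        rw [h.2.2, mem_edgeSet_foldGraph]
      simpa using h₁
    rw [this]
    split_ifs with hs
    · simp [hs, Set.ncard_univ]
    · simp [hs]
  · exact fun i j hij => Set.disjoint_left.2 fun t hi hj => Set.disjoint_left.1 (h.2.1 hij) hi hj

/-- Multisets of edges of `G` that together contain each edge `N` times can be realised by
a partition of the edge set of `foldGraph N G`. -/
lemma exists_edge_partition [DecidableEq α] [Fintype K] (E : K → Multiset (Sym2 α))
    [∀ s, Decidable (s ∈ G.edgeSet)]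
    (hE : ∀ s, (∑ k, E k).count s = if s ∈ G.edgeSet then N else 0) :
    ∃ F : K → Set (Sym2 α × Fin N), Pairwise (fun i j => Disjoint (F i) (F j)) ∧
      (⋃ k, F k) = (foldGraph N G).edgeSet ∧ ∀ k, endsMultiset (F k) = E k := by
  classical
  -- For each pair `s`, the `N` labels are dealt out to the classes according to the multiplicity of
  -- `s` in each `E k`.
  have hψ : ∀ s : G.edgeSet, Nonempty (Fin N ≃ Σ k, Fin ((E k).count s.1)) := fun s => by
    have := hE s
    rw [if_pos s.2, Multiset.count_sum'] at this
    rw [← Fintype.card_eq]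
    simp [this]
  let ψ := fun s => (hψ s).some
  refine ⟨fun k => {e | ∃ h : e.1 ∈ G.edgeSet, (ψ ⟨e.1, h⟩ e.2).1 = k}, fun i j hij => ?_, ?_,
    fun k => ?_⟩
  · exact Set.disjoint_left.2 fun e ⟨_, h⟩ ⟨_, h'⟩ => hij (h.symm.trans h')
  · ext e
    rw [mem_edgeSet_foldGraph, Set.mem_iUnion]
    exact ⟨fun ⟨_, h, _⟩ => h, fun h => ⟨_, h, rfl⟩⟩
  · ext s
    rw [count_endsMultiset]
    by_cases hs : s ∈ G.edgeSet
    · have h₁ : {t : Fin N | (s, t) ∈ {e : Sym2 α × Fin N | ∃ h : e.1 ∈ G.edgeSet,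
          (ψ ⟨e.1, h⟩ e.2).1 = k}}
          = (fun c => (ψ ⟨s, hs⟩).symm ⟨k, c⟩) '' Set.univ := by
        ext t
        simp only [Set.mem_ofPred_eq, hs, exists_true_left, Set.image_univ, Set.mem_range,
          Equiv.symm_apply_eq]
        constructor
        · rintro rfl
          exact ⟨_, rfl⟩
        · rintro ⟨c, hc⟩
          rw [← hc]
      have h₂ : Function.Injective fun c => (ψ ⟨s, hs⟩).symm ⟨k, c⟩ :=
        (ψ ⟨s, hs⟩).symm.injective.comp sigma_mk_injective
      rw [h₁, Set.ncard_image_of_injective _ h₂, Set.ncard_univ, Nat.card_fin]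
    · have h₁ := hE s
      rw [if_neg hs, Multiset.count_sum', sum_eq_zero_iff] at h₁
      simp [hs, h₁ k (mem_univ k)]

end Graphs

end CycleDecomp

namespace CycleDecomp

/-! ### Lifting the decomposition -/

section Main

open Finset

lemma card_filter_sigma_fst {J : Type*} [Fintype J] [DecidableEq J] {V : J → Type*}
    [∀ j, Fintype (V j)] {m : ℕ} (hV : ∀ j, Fintype.card (V j) = m) (p : J → Prop)
    [DecidablePred p] : #{x : Σ j, V j | p x.1} = m * #{j | p j} := by
  have : (univ.filter fun x : Σ j, V j => p x.1) = (univ.filter p).sigma fun _ => univ := by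
    ext x; simp
  rw [this, card_sigma]
  simp [hV, mul_comm]

lemma degree_foldGraph {α : Type*} [Fintype α] {N : ℕ} (G : SimpleGraph α) [DecidableRel G.Adj]
    (x : α) : degree (foldGraph N G) x = N * #{y | G.Adj x y} := by
  have h₁ : (foldGraph N G).loopSet x = ∅ := by
    ext e
    simp only [Set.mem_empty_iff_false, iff_false]
    exact fun h => h.1.ne rfl
  have h₂ : (foldGraph N G).incidenceSet x
      = (fun q : α × Fin N => (s(x, q.1), q.2)) '' ({y | G.Adj x y} ×ˢ Set.univ) := by
    ext ⟨s, t⟩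
    constructor
    · rintro ⟨y, h, h'⟩
      exact ⟨(y, t), ⟨h, trivial⟩, Prod.ext h'.symm rfl⟩
    · rintro ⟨⟨y, t'⟩, ⟨h, -⟩, h'⟩
      exact ⟨y, h, (congrArg Prod.fst h').symm⟩
  have h₃ : Function.Injective (fun q : α × Fin N => (s(x, q.1), q.2)) := by
    rintro ⟨a, b⟩ ⟨c, d⟩ h
    simp only [Prod.mk.injEq] at h
    exact Prod.ext (Sym2.congr_right.1 h.1) h.2
  rw [degree, h₁, h₂, Set.ncard_empty, add_zero, Set.ncard_image_of_injective _ h₃, Set.ncard_prod,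
    Set.ncard_univ, Nat.card_fin, mul_comm, ← Set.ncard_coe_finset]
  simp

variable {J : Type*} [Fintype J] {V : J → Type*} [∀ j, Fintype (V j)] {lam m : ℕ}

/-- Both graphs are regular of the same degree: `lam * m` times the number of other parts. -/
lemma odd_degree_completeMultipartiteMultigraph (hV : ∀ j, Fintype.card (V j) = m)
    (h : ∀ j, Odd (degree (foldGraph (lam * m) (⊤ : SimpleGraph J)) j)) (x : Σ j, V j) :
    Odd (degree (completeMultipartiteMultigraph lam V) x) := by
  classical
  have h₁ := h x.1
  rw [degree_foldGraph] at h₁ ⊢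
  have h₂ := card_filter_sigma_fst hV (fun j => x.1 ≠ j)
  simp only [SimpleGraph.completeMultipartiteGraph, SimpleGraph.comap_adj, SimpleGraph.top_adj]
    at h₁ ⊢
  rwa [h₂, ← mul_assoc]

/-- A decomposition of the complete multigraph into cycles and `1`-factors lifts to a
decomposition of the complete multipartite multigraph. -/
theorem exists_lift_decomposition {κ o : Type*} [Fintype κ] [Fintype o] (hm : 0 < m)
    (hV : ∀ j, Fintype.card (V j) = m)
    {C : κ → Graph J (Sym2 J × Fin (lam * m))} {I : o → Graph J (Sym2 J × Fin (lam * m))}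
    (hC : ∀ i, IsCycle (C i)) (hI : ∀ j, IsOneFactor (I j) (foldGraph (lam * m) ⊤))
    (hD : IsDecomposition (foldGraph (lam * m) ⊤) (Sum.elim C I)) :
    ∃ (C' : κ → Graph (Σ j, V j) (Sym2 (Σ j, V j) × Fin lam))
      (I' : o → Graph (Σ j, V j) (Sym2 (Σ j, V j) × Fin lam)),
      (∀ i, IsCycle (C' i)) ∧
      (∀ j, IsOneFactor (I' j) (completeMultipartiteMultigraph lam V)) ∧
      IsDecomposition (completeMultipartiteMultigraph lam V) (Sum.elim C' I') ∧
      ∀ i, (C' i).vertexSet = ⋃ j ∈ (C i).vertexSet, part V j := by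
  classical
  have hCle : ∀ i, C i ≤ foldGraph (lam * m) ⊤ := fun i => hD.1 (Sum.inl i)
  choose l hl hl2 hlV hlE using fun i => (hC i).exists_list (hCle i)
  have hfib : ∀ j, #{x : Σ j, V j | x.1 = j} = m := fun j => by
    have h := card_filter_sigma_fst hV (fun i => i = j)
    rwa [card_eq_one.2 ⟨j, by ext; simp⟩, mul_one] at h
  obtain ⟨L, M, H⟩ := exists_detachment (lam := lam) hm hfib hl
    (M := fun j => endsMultiset (I j).edgeSet)
    (fun j => (isOneFactor_iff_of_le (hD.1 (Sum.inr j)) (hI j).1.vertexSet_eq).1 (hI j))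
    fun u v => by
      have h := hD.count_sum s(u, v)
      rw [Fintype.sum_sum_type] at h
      simp only [Sum.elim_inl, Sum.elim_inr, hlE, SimpleGraph.mem_edgeSet, SimpleGraph.top_adj] at h
      rw [h]
      split_ifs <;> simp_all
  obtain ⟨F, hF₁, hF₂, hF₃⟩ := exists_edge_partition (N := lam)
    (G := SimpleGraph.completeMultipartiteGraph V)
    (Sum.elim (fun i => cycleEdges (L i)) M) fun s => by
      induction s using Sym2.ind with
      | _ x y =>
        rw [Fintype.sum_sum_type]
        simp only [Sum.elim_inl, Sum.elim_inr, H.count_total, SimpleGraph.mem_edgeSet,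
          SimpleGraph.completeMultipartiteGraph, SimpleGraph.comap_adj, SimpleGraph.top_adj]
        split_ifs <;> simp_all
  have hFsub : ∀ k, F k ⊆ (completeMultipartiteMultigraph lam V).edgeSet := fun k => by
    rw [← hF₂]; exact Set.subset_iUnion F k
  have hmem : ∀ i x, x ∈ L i ↔ x.1 ∈ l i := fun i x => by
    rw [← List.count_pos_iff, H.count_walk]
    split_ifs with h <;> simpa using h
  choose C' hC'le hC'V hC'E using fun i => exists_le_foldGraph (X := {x | x ∈ L i})
    (hFsub (Sum.inl i)) fun e he x hx => by
      have h₁ : e.1 ∈ endsMultiset (F (Sum.inl i)) := mem_endsMultiset.2 ⟨e.2, he⟩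
      rw [hF₃] at h₁
      exact mem_of_mem_cycleEdges h₁ hx
  choose I' hI'le hI'V hI'E using fun j => exists_le_foldGraph (X := Set.univ)
    (hFsub (Sum.inr j)) fun e he x hx => Set.mem_univ x
  have hedge : ∀ k, (Sum.elim C' I' k).edgeSet = F k := by
    rintro (i | j)
    · exact hC'E i
    · exact hI'E j
  refine ⟨C', I', fun i => ?_, fun j => ?_, ⟨?_, ?_, ?_⟩, fun i => ?_⟩
  · refine isCycle_of_list (hC'le i) (List.nodup_iff_count_le_one.2 fun x => ?_) ?_ (fun x => ?_)
      (l := L i) ?_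
    · rw [H.count_walk]; split_ifs <;> simp
    · have h₁ : l i ⊆ (L i).map Sigma.fst := fun j hj => by
        obtain ⟨x⟩ : Nonempty (V j) := Fintype.card_pos_iff.1 (by rw [hV]; exact hm)
        exact List.mem_map.2 ⟨⟨j, x⟩, (hmem i _).2 hj, rfl⟩
      have h₂ := ((hl i).subperm h₁).length_le
      rw [List.length_map] at h₂
      exact (hl2 i).trans h₂
    · rw [hC'V]; rfl
    · rw [hC'E, hF₃]; rfl
  · rw [isOneFactor_iff_of_le (hI'le j) (hI'V j), hI'E, hF₃]
    exact H.card_factor j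
  · rintro (i | j)
    · exact hC'le i
    · exact hI'le j
  · intro a b hab
    rw [hedge, hedge]
    exact hF₁ hab
  · simp only [hedge, hF₂]
  · ext x
    rw [hC'V]
    simp only [Set.mem_ofPred_eq, Set.mem_iUnion, hmem, hlV, part, Set.mem_range, exists_prop]
    constructor
    · exact fun h => ⟨x.1, h, x.2, rfl⟩
    · rintro ⟨j, h, y, rfl⟩; exact h

end Main

end CycleDecomp

theorem mainTheorem1 (lam m n k : ℕ) (hlam : 0 < lam) (hm : 0 < m) (hn : 0 < n)
    (V : ZMod n → Type*) [∀ j, Fintype (V j)] (hV : ∀ j, Fintype.card (V j) = m)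
    (C : Fin k → Graph (ZMod n) (Sym2 (ZMod n) × Fin (lam * m)))
    (hC : CycleDecomp.IsCycleDecomposition (CycleDecomp.completeMultigraph (lam * m) n) C) :
    ∃ C' : Fin k → Graph (Σ j, V j) (Sym2 (Σ j, V j) × Fin lam),
      CycleDecomp.IsCycleDecomposition
        (CycleDecomp.completeMultipartiteMultigraph lam V) C' ∧
      ∀ i, (C' i).vertexSet = ⋃ j ∈ (C i).vertexSet, CycleDecomp.part V j := by
  have : NeZero n := ⟨hn.ne'⟩
  obtain ⟨hcyc, hD | ⟨hodd, I, hI, hD⟩⟩ := hC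
  -- The family of 1-factors is indexed by `Empty` here, and by `PUnit` in the odd case.
  · have hD' : CycleDecomp.IsDecomposition (CycleDecomp.foldGraph (lam * m) ⊤)
        (Sum.elim C (Empty.elim : Empty → _)) := by
      convert hD.comp_equiv (Equiv.sumEmpty (Fin k) Empty) using 1
      funext i
      rcases i with i | i
      · rfl
      · exact i.elim
    obtain ⟨C', I', h₁, -, h₃, h₄⟩ :=
      CycleDecomp.exists_lift_decomposition hm hV hcyc (fun i => i.elim) hD'
    exact ⟨C', ⟨h₁, Or.inl (h₃.comp_equiv (Equiv.sumEmpty (Fin k) Empty).symm)⟩, h₄⟩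
  · have hD' : CycleDecomp.IsDecomposition (CycleDecomp.foldGraph (lam * m) ⊤)
        (Sum.elim C (fun _ : PUnit.{1} => I)) := by
      convert hD.comp_equiv (Equiv.optionEquivSumPUnit.{0} (Fin k)).symm using 1
      funext i
      rcases i with i | i <;> rfl
    obtain ⟨C', I', h₁, h₂, h₃, h₄⟩ :=
      CycleDecomp.exists_lift_decomposition hm hV hcyc (fun _ => hI) hD'
    refine ⟨C', ⟨h₁, Or.inr ⟨fun x _ => ?_, I' PUnit.unit, h₂ _, ?_⟩⟩, h₄⟩
    · exact CycleDecomp.odd_degree_completeMultipartiteMultigraph hV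
        (fun j => hodd j (Set.mem_univ j)) x
    · convert h₃.comp_equiv (Equiv.optionEquivSumPUnit.{0} (Fin k)) using 1
      funext i
      rcases i with - | i <;> rfl
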